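/- Let $n$ be a natural number. Let $SG_n$ be the singular braid group on $n$ strands, i.e. the group generated by $\sigma_1,\dots,\sigma_{n-1}$ and (if $n\ge 2$) $\tau_1$ subject to the relations $$\sigma_i\sigma_{i+1}\sigma_i=\sigma_{i+1}\sigma_i\sigma_{i+1},\qquad \sigma_i\sigma_j=\sigma_j\sigma_i\ (j>i+1),\qquad \sigma_i\tau_1=\tau_1\sigma_i\ (i\neq 2),$$ $$\sigma_2\sigma_1^2\sigma_2\tau_1=\tau_1\sigma_2\sigma_1^2\sigma_2\ (n\ge 3),\qquad \sigma_2\sigma_3\sigma_1\sigma_2\tau_1\sigma_2\sigma_3\sigma_1\sigma_2\tau_1=\tau_1\sigma_2\sigma_3\sigma_1\sigma_2\tau_1\sigma_2\sigma_3\sigma_1\sigma_2\ (n>3),$$ and put $\tau_{i+1}=\sigma_i\sigma_{i+1}\tau_i\sigma_{i+1}^{-1}\sigma_i^{-1}$ for $1\le i\le n-2$. Let $B_n\subset SG_n$ be the braid group, generated by the $\sigma_i$. Let $SGP_n$ be the kernel of the homomorphism from $SG_n$ to the symmetric group $\Sigma_n$ that sends $\sigma_i$ and $\tau_i$ to the transposition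 $(i\ \,i+1)$, and let $P_n=B_n\cap SGP_n$ be the pure braid group. For $1\le i\le j\le n-1$ let $$X_{i,j}=\sigma_j\sigma_{j-1}\cdots\sigma_i\,\tau_i\,\sigma_{i+1}^{-1}\cdots\sigma_{j-1}^{-1}\sigma_j^{-1}\in SGP_n .$$ Let $N$ be the normal closure of $P_n$ in $SGP_n$. Then $SGP_n/N$ is generated by the classes of the elements $X_{i,j}$, $1\le i\le j\le n-1$, and in these generators it has the presentation $$SGP_n/N=\bigl\langle X_{i,j}\ (1\le i\le j\le n-1)\ \big|\ X_{i,j}X_{k,l}=X_{k,l}X_{i,j}\ \text{ whenever } i\neq k,\ i\neq l+1,\ j\neq l,\ j\neq k-1\bigr\rangle .$$ In particular, it is a right-angled Artin group. -/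

import Mathlib

namespace SingularBraid

/-- The braid relators in a family `s 1, …, s (n - 1)` of elements of a group. -/
def braidRels {G : Type*} [Group G] (n : ℕ) (s : ℕ → G) : Set G :=
  {r | ∃ i, 1 ≤ i ∧ i + 1 < n ∧
      r = s i * s (i + 1) * s i * (s (i + 1) * s i * s (i + 1))⁻¹} ∪
  {r | ∃ i j, 1 ≤ i ∧ i + 1 < j ∧ j < n ∧ r = s i * s j * (s j * s i)⁻¹}

/-- The relators of the singular braid group on `n` strands in elements
`s 1, …, s (n - 1)` and `t` of a group (`t` plays the role of `τ₁`). -/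
def singularBraidRels {G : Type*} [Group G] (n : ℕ) (s : ℕ → G) (t : G) : Set G :=
  braidRels n s ∪
  {r | 2 < n ∧ r = s 2 * s 1 ^ 2 * s 2 * t * (t * s 2 * s 1 ^ 2 * s 2)⁻¹} ∪
  {r | ∃ i, 1 ≤ i ∧ i < n ∧ i ≠ 2 ∧ r = s i * t * (t * s i)⁻¹} ∪
  {r | 3 < n ∧
      r = s 2 * s 3 * s 1 * s 2 * t * s 2 * s 3 * s 1 * s 2 * t *
        (t * s 2 * s 3 * s 1 * s 2 * t * s 2 * s 3 * s 1 * s 2)⁻¹}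

/-- The index set `{1, …, n - 1}` of the generators of the braid group. -/
abbrev Idx (n : ℕ) : Type := {i : ℕ // 1 ≤ i ∧ i < n}

/-- The generators `σ₁, …, σ_{n-1}` and (if there are at least two strands) `τ₁`
of the singular braid group. -/
inductive SGen (n : ℕ) : Type
  | sigma (i : Idx n) : SGen n
  | tauOne (h : 2 ≤ n) : SGen n

/-- The letter `σ_i` of the free group on `σ₁, …, σ_{n-1}` (and `1` outside the index range). -/
def bLetter (n i : ℕ) : FreeGroup (Idx n) :=
  if h : 1 ≤ i ∧ i < n then FreeGroup.of ⟨i, h⟩ else 1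

/-- The letter `σ_i` of the free group on `σ₁, …, σ_{n-1}, τ₁` (and `1` outside the range). -/
def sLetter (n i : ℕ) : FreeGroup (SGen n) :=
  if h : 1 ≤ i ∧ i < n then FreeGroup.of (SGen.sigma ⟨i, h⟩) else 1

/-- The letter `τ₁` of the free group on `σ₁, …, σ_{n-1}, τ₁` (and `1` if `n < 2`). -/
def tLetter (n : ℕ) : FreeGroup (SGen n) :=
  if h : 2 ≤ n then FreeGroup.of (SGen.tauOne h) else 1

/-- The braid group `B_n`. -/
abbrev B (n : ℕ) : Type := PresentedGroup (braidRels n (bLetter n))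

/-- The singular braid group `SG_n`. -/
abbrev SG (n : ℕ) : Type := PresentedGroup (singularBraidRels n (sLetter n) (tLetter n))

/-- The element `σ_i` of `SG_n`, for `1 ≤ i ≤ n - 1` (and `1` otherwise). -/
def σ (n i : ℕ) : SG n := PresentedGroup.mk _ (sLetter n i)

/-- The element `τ_i` of `SG_n`, for `1 ≤ i ≤ n - 1`: the generator `τ₁` for `i = 1`, and
`τ_{i+1} = σ_i σ_{i+1} τ_i σ_{i+1}⁻¹ σ_i⁻¹`. The value at `0` is irrelevant. -/
def τ (n : ℕ) : ℕ → SG n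
  | 0 => 1
  | 1 => PresentedGroup.mk _ (tLetter n)
  | i + 2 => σ n (i + 1) * σ n (i + 2) * τ n (i + 1) * (σ n (i + 2))⁻¹ * (σ n (i + 1))⁻¹

/-- The transposition of the `i`-th and the `(i+1)`-st of `n` points, counted from one
(these are the elements `i - 1` and `i` of `Fin n`), for `1 ≤ i ≤ n - 1`. -/
def adjSwap (n i : ℕ) : Equiv.Perm (Fin n) :=
  if h : 1 ≤ i ∧ i < n then Equiv.swap ⟨i - 1, by omega⟩ ⟨i, h.2⟩ else 1

theorem adjSwap_mul_self (n i : ℕ) : adjSwap n i * adjSwap n i = 1 := by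
  unfold adjSwap; split_ifs <;> simp

theorem adjSwap_braid (n i : ℕ) (h1 : 1 ≤ i) (h2 : i + 1 < n) :
    adjSwap n i * adjSwap n (i + 1) * adjSwap n i =
      adjSwap n (i + 1) * adjSwap n i * adjSwap n (i + 1) := by
  have ha : 1 ≤ i ∧ i < n := by omega
  have hb : 1 ≤ i + 1 ∧ i + 1 < n := by omega
  rw [adjSwap, adjSwap, dif_pos ha, dif_pos hb]
  ext x
  simp only [Equiv.Perm.coe_mul, Function.comp_apply, Equiv.swap_apply_def, Fin.ext_iff,
    Nat.add_sub_cancel]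
  grind

theorem adjSwap_comm (n i j : ℕ) (hij : i + 1 < j) :
    adjSwap n i * adjSwap n j = adjSwap n j * adjSwap n i := by
  unfold adjSwap
  split_ifs with ha hb
  · ext x
    simp only [Equiv.Perm.coe_mul, Function.comp_apply, Equiv.swap_apply_def, Fin.ext_iff]
    grind
  all_goals simp

theorem adjSwap_braidRels (n : ℕ) : ∀ r ∈ braidRels n (adjSwap n), r = 1 := by
  rintro r (⟨i, h1, h2, rfl⟩ | ⟨i, j, -, h2, -, rfl⟩)
  · rw [adjSwap_braid n i h1 h2, mul_inv_cancel]
  · rw [adjSwap_comm n i j h2, mul_inv_cancel]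

theorem map_braidRels {G H : Type*} [Group G] [Group H] (f : G →* H) (n : ℕ) (s : ℕ → G)
    {r : G} (hr : r ∈ braidRels n s) : f r ∈ braidRels n (fun i => f (s i)) := by
  rcases hr with ⟨i, h1, h2, rfl⟩ | ⟨i, j, h1, h2, h3, rfl⟩
  · exact Or.inl ⟨i, h1, h2, by simp⟩
  · exact Or.inr ⟨i, j, h1, h2, h3, by simp⟩

theorem map_singularBraidRels {G H : Type*} [Group G] [Group H] (f : G →* H) (n : ℕ)
    (s : ℕ → G) (t : G) {r : G} (hr : r ∈ singularBraidRels n s t) :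
    f r ∈ singularBraidRels n (fun i => f (s i)) (f t) := by
  rcases hr with ((hr | ⟨h, rfl⟩) | ⟨i, h1, h2, h3, rfl⟩) | ⟨h, rfl⟩
  · exact Or.inl (Or.inl (Or.inl (map_braidRels f n s hr)))
  · exact Or.inl (Or.inl (Or.inr ⟨h, by simp⟩))
  · exact Or.inl (Or.inr ⟨i, h1, h2, h3, by simp⟩)
  · exact Or.inr ⟨h, by simp⟩

/-- The images of the generators of `SG_n` in the symmetric group. -/
def genPerm (n : ℕ) : SGen n → Equiv.Perm (Fin n)
  | SGen.sigma i => adjSwap n i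
  | SGen.tauOne _ => adjSwap n 1

theorem lift_bLetter (n : ℕ) {G : Type*} [Group G] (s : ℕ → G)
    (hs : ∀ i, ¬ (1 ≤ i ∧ i < n) → s i = 1) (i : ℕ) :
    FreeGroup.lift (fun i : Idx n => s i) (bLetter n i) = s i := by
  unfold bLetter
  split_ifs with h
  · simp
  · simp [hs i h]

theorem lift_sLetter (n i : ℕ) : FreeGroup.lift (genPerm n) (sLetter n i) = adjSwap n i := by
  unfold sLetter
  split_ifs with h
  · simp [genPerm]
  · simp [adjSwap, h]

theorem lift_tLetter (n : ℕ) : FreeGroup.lift (genPerm n) (tLetter n) = adjSwap n 1 := by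
  unfold tLetter
  split_ifs with h
  · simp [genPerm]
  · have : ¬ (1 ≤ 1 ∧ 1 < n) := by omega
    rw [map_one, adjSwap, dif_neg this]

theorem bPerm_rels (n : ℕ) : ∀ r ∈ braidRels n (bLetter n),
    FreeGroup.lift (fun i : Idx n => adjSwap n i) r = 1 := by
  intro r hr
  have h := map_braidRels (FreeGroup.lift (fun i : Idx n => adjSwap n i)) n _ hr
  have hs : ∀ i, ¬ (1 ≤ i ∧ i < n) → adjSwap n i = 1 := fun i hi => by
    rw [adjSwap, dif_neg hi]
  simp only [lift_bLetter n (adjSwap n) hs] at h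
  exact adjSwap_braidRels n _ h

theorem sPerm_rels (n : ℕ) : ∀ r ∈ singularBraidRels n (sLetter n) (tLetter n),
    FreeGroup.lift (genPerm n) r = 1 := by
  intro r hr
  have h := map_singularBraidRels (FreeGroup.lift (genPerm n)) n _ _ hr
  simp only [lift_sLetter, lift_tLetter] at h
  have q := adjSwap_mul_self n
  rcases h with ((h | ⟨h, e⟩) | ⟨i, h1, h2, h3, e⟩) | ⟨h, e⟩
  · exact adjSwap_braidRels n _ h
  · rw [e]; simp [pow_two, q, mul_assoc]
  · rw [e, mul_inv_eq_one]
    rcases (by omega : i = 1 ∨ 1 + 1 < i) with rfl | hi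
    · rfl
    · exact (adjSwap_comm n 1 i hi).symm
  · rw [e, mul_inv_eq_one]
    have c := adjSwap_comm n 1 3 (by omega)
    have h4 : 4 ≤ n := h
    have e1 : adjSwap n 1 = Equiv.swap ⟨0, by omega⟩ ⟨1, by omega⟩ := by
      rw [adjSwap, dif_pos (by omega)]
    have e2 : adjSwap n 2 = Equiv.swap ⟨1, by omega⟩ ⟨2, by omega⟩ := by
      rw [adjSwap, dif_pos (by omega)]
    have e3 : adjSwap n 3 = Equiv.swap ⟨2, by omega⟩ ⟨3, by omega⟩ := by
      rw [adjSwap, dif_pos (by omega)]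
    -- conjugation by `s 2 * s 3 * s 1 * s 2` exchanges `s 1` and `s 3`
    have k1 : adjSwap n 2 * adjSwap n 3 * adjSwap n 1 * adjSwap n 2 * adjSwap n 1 =
        adjSwap n 3 * (adjSwap n 2 * adjSwap n 3 * adjSwap n 1 * adjSwap n 2) := by
      rw [e1, e2, e3]; ext x
      simp only [Equiv.Perm.coe_mul, Function.comp_apply, Equiv.swap_apply_def, Fin.ext_iff]
      grind
    have k3 : adjSwap n 2 * adjSwap n 3 * adjSwap n 1 * adjSwap n 2 * adjSwap n 3 =
        adjSwap n 1 * (adjSwap n 2 * adjSwap n 3 * adjSwap n 1 * adjSwap n 2) := by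
      rw [e1, e2, e3]; ext x
      simp only [Equiv.Perm.coe_mul, Function.comp_apply, Equiv.swap_apply_def, Fin.ext_iff]
      grind
    have key : ∀ a c w : Equiv.Perm (Fin n), w * a = c * w → w * c = a * w → a * c = c * a →
        w * a * w * a = a * w * a * w := by
      intro a c w h1 h3 hc
      calc w * a * w * a = c * w * (w * a) := by conv_lhs => rw [h1, mul_assoc]
        _ = c * (w * c) * w := by rw [h1]; simp only [mul_assoc]
        _ = a * (c * w) * w := by rw [h3, ← mul_assoc, ← mul_assoc, hc]
        _ = a * w * a * w := by rw [← h1]; simp only [mul_assoc]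
    simpa only [mul_assoc] using key _ _ _ k1 k3 c

/-- The natural homomorphism `B_n → Σ_n`. -/
def bPerm (n : ℕ) : B n →* Equiv.Perm (Fin n) :=
  PresentedGroup.toGroup (bPerm_rels n)

/-- The natural homomorphism `SG_n → Σ_n`, sending `σ_i` and `τ_i` to the transposition
`(i, i + 1)`. -/
def sPerm (n : ℕ) : SG n →* Equiv.Perm (Fin n) :=
  PresentedGroup.toGroup (sPerm_rels n)

/-- The pure braid group `P_n`, as a subgroup of `B_n`. -/
def P (n : ℕ) : Subgroup (B n) := (bPerm n).ker

/-- The pure singular braid group `SGP_n`. -/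
def SGP (n : ℕ) : Subgroup (SG n) := (sPerm n).ker

theorem σ_of_not (n i : ℕ) (h : ¬ (1 ≤ i ∧ i < n)) : σ n i = 1 := by
  simp [σ, sLetter, h]

theorem incl_rels (n : ℕ) : ∀ r ∈ braidRels n (bLetter n),
    FreeGroup.lift (fun i : Idx n => σ n i) r = 1 := by
  intro r hr
  have h := map_braidRels (FreeGroup.lift (fun i : Idx n => σ n i)) n _ hr
  simp only [lift_bLetter n (σ n) (σ_of_not n)] at h
  generalize FreeGroup.lift (fun i : Idx n => σ n i) r = g at h ⊢
  rcases h with ⟨i, h1, h2, rfl⟩ | ⟨i, j, h1, h2, h3, rfl⟩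
  · refine PresentedGroup.one_of_mem (rels := singularBraidRels n (sLetter n) (tLetter n))
      (Or.inl (Or.inl (Or.inl (Or.inl ⟨i, h1, h2, rfl⟩))))
  · refine PresentedGroup.one_of_mem (rels := singularBraidRels n (sLetter n) (tLetter n))
      (Or.inl (Or.inl (Or.inl (Or.inr ⟨i, j, h1, h2, h3, rfl⟩))))

/-- The natural homomorphism `B_n → SG_n`, `σ_i ↦ σ_i`. -/
def incl (n : ℕ) : B n →* SG n := PresentedGroup.toGroup (incl_rels n)

/-- The letters of `SG_n` mapped to `B_n`, with `τ₁ ↦ 1`. -/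
def retrGen (n : ℕ) : SGen n → B n
  | SGen.sigma i => PresentedGroup.of i
  | SGen.tauOne _ => 1

theorem retr_sLetter (n i : ℕ) :
    FreeGroup.lift (retrGen n) (sLetter n i) = PresentedGroup.mk _ (bLetter n i) := by
  by_cases h : 1 ≤ i ∧ i < n
  · rw [sLetter, bLetter, dif_pos h, dif_pos h, FreeGroup.lift_apply_of]; rfl
  · rw [sLetter, bLetter, dif_neg h, dif_neg h, map_one, map_one]

theorem retr_rels (n : ℕ) : ∀ r ∈ singularBraidRels n (sLetter n) (tLetter n),
    FreeGroup.lift (retrGen n) r = 1 := by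
  intro r hr
  have h := map_singularBraidRels (FreeGroup.lift (retrGen n)) n _ _ hr
  have ht : FreeGroup.lift (retrGen n) (tLetter n) = 1 := by
    unfold tLetter
    split_ifs with h
    · simp [retrGen]
    · simp
  simp only [retr_sLetter, ht] at h
  rcases h with ((h | ⟨h, e⟩) | ⟨i, h1, h2, h3, e⟩) | ⟨h, e⟩
  · generalize FreeGroup.lift (retrGen n) r = g at h ⊢
    rcases h with ⟨i, h1, h2, rfl⟩ | ⟨i, j, h1, h2, h3, rfl⟩
    · exact PresentedGroup.one_of_mem (rels := braidRels n (bLetter n))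
        (Or.inl ⟨i, h1, h2, rfl⟩)
    · exact PresentedGroup.one_of_mem (rels := braidRels n (bLetter n))
        (Or.inr ⟨i, j, h1, h2, h3, rfl⟩)
  all_goals rw [e]; simp [mul_assoc]

/-- `B_n` is a subgroup of `SG_n`. -/
theorem incl_injective (n : ℕ) : Function.Injective (incl n) := by
  have h : ((PresentedGroup.toGroup (retr_rels n)).comp (incl n)) = MonoidHom.id (B n) := by
    ext i
    have hi : 1 ≤ (i : ℕ) ∧ (i : ℕ) < n := i.2
    simp only [MonoidHom.comp_apply, incl, PresentedGroup.toGroup.of, MonoidHom.id_apply]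
    have : σ n i = PresentedGroup.of (SGen.sigma i) := by
      simp [σ, sLetter, hi, PresentedGroup.of]
    rw [this, PresentedGroup.toGroup.of]
    rfl
  exact Function.LeftInverse.injective fun x => DFunLike.congr_fun h x

theorem sPerm_σ (n i : ℕ) : sPerm n (σ n i) = adjSwap n i := lift_sLetter n i

theorem sPerm_incl (n : ℕ) : (sPerm n).comp (incl n) = bPerm n := by
  ext1 i
  simp only [MonoidHom.comp_apply, incl, bPerm, PresentedGroup.toGroup.of, sPerm_σ]

/-- `P_n` is contained in `SGP_n`. -/
theorem P_le_SGP (n : ℕ) : (P n).map (incl n) ≤ SGP n := by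
  rintro _ ⟨b, hb, rfl⟩
  exact (DFunLike.congr_fun (sPerm_incl n) b).trans hb

theorem sPerm_τ (n : ℕ) : ∀ i, 1 ≤ i → i < n → sPerm n (τ n i) = adjSwap n i
  | 0, h, _ => absurd h (by omega)
  | 1, _, _ => lift_tLetter n
  | i + 2, _, h => by
    have ih := sPerm_τ n (i + 1) (by omega) (by omega)
    have b := adjSwap_braid n (i + 1) (by omega) h
    simp only [τ, map_mul, map_inv, sPerm_σ, ih]
    rw [b, mul_assoc _ (adjSwap n (i + 1 + 1)), mul_inv_cancel, mul_one, mul_inv_cancel_right]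

/-- The product `σ_j σ_{j-1} ⋯ σ_{k+1}`. -/
def descProd (n k j : ℕ) : SG n := ((List.range' (k + 1) (j - k)).reverse.map (σ n)).prod

/-- The element
`X_{k,j} = σ_j σ_{j-1} ⋯ σ_{k+1} σ_k τ_k σ_{k+1}⁻¹ ⋯ σ_{j-1}⁻¹ σ_j⁻¹` of `SG_n`. -/
def X (n k j : ℕ) : SG n := descProd n k j * σ n k * τ n k * (descProd n k j)⁻¹

theorem X_mem (n k j : ℕ) (h1 : 1 ≤ k) (h2 : k < n) : X n k j ∈ SGP n := by
  rw [SGP, MonoidHom.mem_ker, X]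
  simp [sPerm_σ, sPerm_τ n k h1 h2, mul_assoc]
  rw [← mul_assoc (adjSwap n k), adjSwap_mul_self, one_mul, mul_inv_cancel]

/-- The index set of the `X_{i,j}`, `1 ≤ i ≤ j ≤ n - 1`. -/
abbrev XIdx (n : ℕ) : Type := {p : ℕ × ℕ // 1 ≤ p.1 ∧ p.1 ≤ p.2 ∧ p.2 < n}

/-- The generators `X_{i,j}` as elements of `SGP_n`. -/
def XGen (n : ℕ) (p : XIdx n) : SGP n :=
  ⟨X n p.1.1 p.1.2, X_mem n _ _ p.2.1 (lt_of_le_of_lt p.2.2.1 p.2.2.2)⟩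

/-- The normal closure `N` of `P_n` in `SGP_n`. -/
abbrev N (n : ℕ) : Subgroup (SGP n) :=
  Subgroup.normalClosure (((P n).map (incl n)).subgroupOf (SGP n) : Set (SGP n))

/-- The relators `[x_{i,j}, x_{k,l}]` for `i ≠ k`, `i ≠ l + 1`, `j ≠ l`, `j ≠ k - 1`. -/
def commRels (n : ℕ) : Set (FreeGroup (XIdx n)) :=
  {r | ∃ p q : XIdx n,
      (p.1.1 ≠ q.1.1 ∧ p.1.1 ≠ q.1.2 + 1) ∧ (p.1.2 ≠ q.1.2 ∧ p.1.2 ≠ q.1.1 - 1) ∧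
      r = FreeGroup.of p * FreeGroup.of q * (FreeGroup.of q * FreeGroup.of p)⁻¹}

end SingularBraid

/-! Number the strands `0, …, n - 1` and attach `X_{i,j}` to the pair `{i - 1, j}`. The required
commutations are then exactly those between disjoint pairs. So `Σ_n` acts on the right-angled Artin
group `A = RA n`, with generators `x_{ab} = x_{ba}`, by permuting the points.

Sending `σ_i` to its transposition `s_i` and `τ₁` to `x_{01} s₁` defines `toSD : SG_n → A ⋊ Σ_n`;
the four-strand relation becomes the commutation of `x_{01}` and `x_{23}`. Pure braids die, and on
`SGP_n` this restricts to a homomorphism onto `A` that takes `X_{i,j}` to its generator (`toSD_X`).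

It remains to see that the kernel is no larger than `N`. As `SG_n = SGP_n · B_n` and `B_n`
normalizes `P_n`, the subgroup `N` is normal in `SG_n` (`NS_normal`), and in `SG_n / N` the braids
act through `Σ_n`. The class of `σ₁ τ₁` commutes with `s₁` and with all `s_i`, `i ≥ 3`, so its
conjugates are indexed by unordered pairs (`conjQ_congr`, `conjQ_mul_adjSwap_one`); by the
four-strand relation those of disjoint pairs commute (`commute_conjQ`). This gives a homomorphism `A
⋊ Σ_n → SG_n / N` whose composite with `toSD` is the quotient map (`sdToQ_comp_toSD`), hence `ker
toSD ⊆ N`. -/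

namespace SingularBraid

/-! ### Permutations -/

theorem adjSwap_apply_pred (n i : ℕ) (h1 : 1 ≤ i) (h2 : i < n) :
    adjSwap n i ⟨i - 1, by omega⟩ = ⟨i, h2⟩ := by
  rw [adjSwap, dif_pos ⟨h1, h2⟩, Equiv.swap_apply_left]

theorem adjSwap_apply_self (n i : ℕ) (h1 : 1 ≤ i) (h2 : i < n) :
    adjSwap n i ⟨i, h2⟩ = ⟨i - 1, by omega⟩ := by
  rw [adjSwap, dif_pos ⟨h1, h2⟩, Equiv.swap_apply_right]

theorem adjSwap_apply_of_ne (n i : ℕ) (x : Fin n) (h1 : (x : ℕ) + 1 ≠ i) (h2 : (x : ℕ) ≠ i) :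
    adjSwap n i x = x := by
  unfold adjSwap
  split_ifs with h
  · refine Equiv.swap_apply_of_ne_of_ne ?_ ?_ <;> rw [Ne, Fin.ext_iff] <;> simp only <;> omega
  · rfl

/-- A subgroup containing the adjacent transpositions of the points from `c` on contains all
transpositions of these points. -/
theorem swap_mem_of_adjSwap_mem {n : ℕ} (H : Subgroup (Equiv.Perm (Fin n))) (c : ℕ)
    (hH : ∀ i, c < i → i < n → adjSwap n i ∈ H) (a b : Fin n) (ha : c ≤ (a : ℕ))
    (hb : c ≤ (b : ℕ)) : Equiv.swap a b ∈ H := by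
  have key : ∀ (d : ℕ) (a b : Fin n), c ≤ (a : ℕ) → (a : ℕ) + d = b → Equiv.swap a b ∈ H := by
    intro d
    induction d with
    | zero =>
      intro a b _ h
      rw [Fin.ext (a := a) (b := b) (by omega), Equiv.swap_self]
      exact H.one_mem
    | succ d ih =>
      intro a b ha h
      have hb : 1 ≤ (b : ℕ) := by omega
      have hs := hH b (by omega) b.2
      rcases Nat.eq_zero_or_pos d with rfl | hd
      · rw [adjSwap, dif_pos ⟨hb, b.2⟩] at hs
        convert hs using 2
        exact Fin.ext (by simp only; omega)
      · have hm := ih a ⟨(b : ℕ) - 1, by omega⟩ ha (by simp only; omega)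
        -- Conjugating the transposition of `a` and `b - 1` by that of `b - 1` and `b` yields the
        -- transposition of `a` and `b`.
        have := H.mul_mem (H.mul_mem hs hm) (H.inv_mem hs)
        rwa [← Equiv.swap_apply_apply, adjSwap_apply_of_ne n b a (by omega) (by omega),
          adjSwap_apply_pred n b hb b.2] at this
  rcases le_total (a : ℕ) b with h | h
  · exact key (b - a) a b ha (by omega)
  · rw [Equiv.swap_comm]
    exact key (a - b) b a hb (by omega)

/-- A subgroup containing the adjacent transpositions of the points from `c` on contains all
permutations that fix the points below `c`. -/
theorem mem_of_adjSwap_mem {n : ℕ} (H : Subgroup (Equiv.Perm (Fin n))) (c : ℕ)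
    (hH : ∀ i, c < i → i < n → adjSwap n i ∈ H) (π : Equiv.Perm (Fin n))
    (hπ : ∀ x : Fin n, (x : ℕ) < c → π x = x) : π ∈ H := by
  have hmem : ∀ x, c ≤ (π x : ℕ) ↔ c ≤ (x : ℕ) := by
    intro x
    constructor
    · intro h
      by_contra hx
      rw [hπ x (by omega)] at h
      exact hx h
    · intro h
      by_contra hx
      have := π.injective (hπ (π x) (by omega))
      omega
  have hmove : ∀ x, π x ≠ x → c ≤ (x : ℕ) := fun x hx => by
    by_contra h
    exact hx (hπ x (by omega))
  have htop : H.comap (Equiv.Perm.ofSubtype (p := fun x : Fin n => c ≤ (x : ℕ))) = ⊤ := by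
    rw [eq_top_iff, ← Equiv.Perm.closure_isSwap, Subgroup.closure_le]
    rintro _ ⟨a, b, -, rfl⟩
    rw [SetLike.mem_coe, Subgroup.mem_comap, Equiv.Perm.ofSubtype_swap_eq]
    exact swap_mem_of_adjSwap_mem H c hH a b a.2 b.2
  have : π.subtypePerm hmem ∈ H.comap
      (Equiv.Perm.ofSubtype (p := fun x : Fin n => c ≤ (x : ℕ))) := htop ▸ Subgroup.mem_top _
  rwa [Subgroup.mem_comap, Equiv.Perm.ofSubtype_subtypePerm hmem hmove] at this

theorem exists_perm_apply_eq {m n : ℕ} {f g : Fin m → Fin n} (hf : Function.Injective f)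
    (hg : Function.Injective g) : ∃ π : Equiv.Perm (Fin n), ∀ i, π (f i) = g i := by
  have := Equiv.Perm.isMultiplyPretransitive (Fin n) m
  obtain ⟨π, hπ⟩ := MulAction.exists_smul_eq (Equiv.Perm (Fin n))
    (⟨f, hf⟩ : Fin m ↪ Fin n) ⟨g, hg⟩
  exact ⟨π, fun i => DFunLike.congr_fun hπ i⟩

theorem bPerm_surjective (n : ℕ) : Function.Surjective (bPerm n) := by
  intro π
  refine mem_of_adjSwap_mem (bPerm n).range 0 (fun i h1 h2 => ?_) π (by simp)
  exact ⟨PresentedGroup.of ⟨i, h1, h2⟩, PresentedGroup.toGroup.of _⟩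

/-! ### The right-angled Artin group and its action of the symmetric group -/

/-- The right-angled Artin group of the statement. -/
abbrev RA (n : ℕ) : Type := PresentedGroup (commRels n)

/-- The generator of the right-angled Artin group that belongs to the unordered pair `{a, b}`
(and `1` if `a = b`); the generator `x_{i,j}` belongs to the pair `{i - 1, j}`. -/
def pairGen {n : ℕ} (a b : Fin n) : RA n :=
  if h : a < b then PresentedGroup.of ⟨(a + 1, b), by simp only; omega, by simp only; omega, b.2⟩
  else if h : b < a then
    PresentedGroup.of ⟨(b + 1, a), by simp only; omega, by simp only; omega, a.2⟩
  else 1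

theorem pairGen_of_lt {n : ℕ} {a b : Fin n} (h : a < b) : pairGen a b = PresentedGroup.of
    (rels := commRels n) ⟨(a + 1, b), by simp only; omega, by simp only; omega, b.2⟩ :=
  dif_pos h

theorem pairGen_comm {n : ℕ} (a b : Fin n) : pairGen a b = pairGen b a := by
  unfold pairGen
  split_ifs with h1 h2
  · exact absurd h1 h2.asymm
  all_goals rfl

theorem pairGen_self {n : ℕ} (a : Fin n) : pairGen a a = 1 := by
  simp [pairGen]

/-- The first point of the pair of the generator `x_p`. -/
def XIdx.fst {n : ℕ} (p : XIdx n) : Fin n :=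
  ⟨p.1.1 - 1, lt_of_le_of_lt ((Nat.sub_le _ _).trans p.2.2.1) p.2.2.2⟩

/-- The second point of the pair of the generator `x_p`. -/
def XIdx.snd {n : ℕ} (p : XIdx n) : Fin n := ⟨p.1.2, p.2.2.2⟩

theorem XIdx.fst_lt_snd {n : ℕ} (p : XIdx n) : p.fst < p.snd := by
  have := p.2
  rw [Fin.lt_def, XIdx.fst, XIdx.snd]
  simp only
  omega

theorem pairGen_fst_snd {n : ℕ} (p : XIdx n) : pairGen p.fst p.snd = PresentedGroup.of p := by
  rw [pairGen_of_lt p.fst_lt_snd]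
  congr 1
  obtain ⟨⟨i, j⟩, h1, h2, h3⟩ := p
  exact Subtype.ext (Prod.ext (Nat.sub_add_cancel h1) rfl)

theorem exists_of_lt {n : ℕ} {a b : Fin n} (h : a < b) : ∃ p : XIdx n, p.fst = a ∧ p.snd = b :=
  ⟨⟨(a + 1, b), by simp only; omega, by simp only; omega, b.2⟩,
    Fin.ext (Nat.add_sub_cancel _ _), rfl⟩

/-- Two generators are required to commute exactly when their pairs are disjoint. -/
theorem commRels_iff {n : ℕ} (p q : XIdx n) :
    (p.1.1 ≠ q.1.1 ∧ p.1.1 ≠ q.1.2 + 1) ∧ (p.1.2 ≠ q.1.2 ∧ p.1.2 ≠ q.1.1 - 1) ↔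
      p.fst ≠ q.fst ∧ p.fst ≠ q.snd ∧ p.snd ≠ q.fst ∧ p.snd ≠ q.snd := by
  have := p.2
  have := q.2
  simp only [XIdx.fst, XIdx.snd, Ne, Fin.ext_iff]
  omega

theorem commute_pairGen {n : ℕ} {a b c d : Fin n} (h1 : a ≠ c) (h2 : a ≠ d) (h3 : b ≠ c)
    (h4 : b ≠ d) : Commute (pairGen a b) (pairGen c d) := by
  have key : ∀ {a b c d : Fin n}, a < b → c < d → a ≠ c → a ≠ d → b ≠ c → b ≠ d →
      Commute (pairGen a b) (pairGen c d) := by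
    intro a b c d hab hcd h1 h2 h3 h4
    obtain ⟨p, rfl, rfl⟩ := exists_of_lt hab
    obtain ⟨q, rfl, rfl⟩ := exists_of_lt hcd
    rw [pairGen_fst_snd, pairGen_fst_snd, Commute, SemiconjBy, ← mul_inv_eq_one]
    exact PresentedGroup.one_of_mem (rels := commRels n)
      ⟨p, q, ((commRels_iff p q).2 ⟨h1, h2, h3, h4⟩).1,
        ((commRels_iff p q).2 ⟨h1, h2, h3, h4⟩).2, rfl⟩
  rcases lt_trichotomy a b with hab | rfl | hab
  · rcases lt_trichotomy c d with hcd | rfl | hcd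
    · exact key hab hcd h1 h2 h3 h4
    · rw [pairGen_self]; exact Commute.one_right _
    · rw [pairGen_comm c d]; exact key hab hcd h2 h1 h4 h3
  · rw [pairGen_self]; exact Commute.one_left _
  · rw [pairGen_comm a b]
    rcases lt_trichotomy c d with hcd | rfl | hcd
    · exact key hab hcd h3 h4 h1 h2
    · rw [pairGen_self]; exact Commute.one_right _
    · rw [pairGen_comm c d]; exact key hab hcd h4 h3 h2 h1

/-- A homomorphism from the right-angled Artin group is given by elements that commute for
disjoint pairs. -/
theorem commRels_lift {n : ℕ} {G : Type*} [Group G] (y : XIdx n → G)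
    (hy : ∀ p q : XIdx n, p.fst ≠ q.fst → p.fst ≠ q.snd → p.snd ≠ q.fst → p.snd ≠ q.snd →
      Commute (y p) (y q)) : ∀ r ∈ commRels n, FreeGroup.lift y r = 1 := by
  rintro _ ⟨p, q, h, h', rfl⟩
  obtain ⟨h1, h2, h3, h4⟩ := (commRels_iff p q).1 ⟨h, h'⟩
  simp only [map_mul, map_inv, FreeGroup.lift_apply_of]
  rw [mul_inv_eq_one]
  exact hy p q h1 h2 h3 h4

/-- A permutation acts on the right-angled Artin group by permuting the pairs. -/
def permHom {n : ℕ} (π : Equiv.Perm (Fin n)) : RA n →* RA n :=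
  PresentedGroup.toGroup (commRels_lift (fun p => pairGen (π p.fst) (π p.snd))
    fun _ _ h1 h2 h3 h4 => commute_pairGen (π.injective.ne h1) (π.injective.ne h2)
      (π.injective.ne h3) (π.injective.ne h4))

theorem permHom_pairGen {n : ℕ} (π : Equiv.Perm (Fin n)) (a b : Fin n) :
    permHom π (pairGen a b) = pairGen (π a) (π b) := by
  have key : ∀ {a b : Fin n}, a < b → permHom π (pairGen a b) = pairGen (π a) (π b) := by
    intro a b h
    obtain ⟨p, rfl, rfl⟩ := exists_of_lt h
    rw [pairGen_fst_snd, permHom, PresentedGroup.toGroup.of]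
  rcases lt_trichotomy a b with h | rfl | h
  · exact key h
  · rw [pairGen_self, pairGen_self, map_one]
  · rw [pairGen_comm a b, pairGen_comm (π a)]; exact key h

theorem permHom_one (n : ℕ) : permHom (1 : Equiv.Perm (Fin n)) = MonoidHom.id _ := by
  ext p
  rw [← pairGen_fst_snd, permHom_pairGen]
  rfl

theorem permHom_mul {n : ℕ} (π ρ : Equiv.Perm (Fin n)) :
    permHom (π * ρ) = (permHom π).comp (permHom ρ) := by
  ext p
  rw [← pairGen_fst_snd, MonoidHom.comp_apply, permHom_pairGen, permHom_pairGen, permHom_pairGen]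
  rfl

/-- The action of the symmetric group on the right-angled Artin group. -/
def permAut (n : ℕ) : Equiv.Perm (Fin n) →* MulAut (RA n) :=
  MonoidHom.mk'
    (fun π => MonoidHom.toMulEquiv (permHom π) (permHom π⁻¹)
      (by rw [← permHom_mul, inv_mul_cancel, permHom_one])
      (by rw [← permHom_mul, mul_inv_cancel, permHom_one]))
    (fun π ρ => MulEquiv.ext fun x => DFunLike.congr_fun (permHom_mul π ρ) x)

theorem permAut_pairGen {n : ℕ} (π : Equiv.Perm (Fin n)) (a b : Fin n) :
    permAut n π (pairGen a b) = pairGen (π a) (π b) :=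
  permHom_pairGen π a b


/-! ### The homomorphism to the semidirect product -/

/-- The semidirect product of the right-angled Artin group and the symmetric group. -/
abbrev SD (n : ℕ) : Type := RA n ⋊[permAut n] Equiv.Perm (Fin n)

/-- The images of the generators of `SG_n` in the semidirect product. -/
def genSD (n : ℕ) : SGen n → SD n
  | SGen.sigma i => SemidirectProduct.inr (adjSwap n i)
  -- The element `x_{01} s₁`: since `s₁` preserves the pair `{0, 1}`, the product `σ₁ τ₁` goes to
  -- `x_{01}`.
  | SGen.tauOne h => ⟨pairGen ⟨0, by omega⟩ ⟨1, by omega⟩, adjSwap n 1⟩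

theorem lift_genSD_sLetter (n i : ℕ) :
    FreeGroup.lift (genSD n) (sLetter n i) = SemidirectProduct.inr (adjSwap n i) := by
  unfold sLetter
  split_ifs with h
  · simp [genSD]
  · simp [adjSwap, h]

theorem lift_genSD_tLetter (n : ℕ) (h : 2 ≤ n) : FreeGroup.lift (genSD n) (tLetter n) =
    ⟨pairGen ⟨0, by omega⟩ ⟨1, by omega⟩, adjSwap n 1⟩ := by
  simp [tLetter, h, genSD]

theorem rightHom_comp_lift_genSD (n : ℕ) :
    SemidirectProduct.rightHom.comp (FreeGroup.lift (genSD n)) =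
      FreeGroup.lift (genPerm n) := by
  ext g : 1
  cases g <;> simp [genSD, genPerm]

/-- The permutation components of the relators are already settled by `sPerm_rels`, so only the
components in the Artin group have to be compared. -/
theorem mul_inv_eq_one_of_left_eq {n : ℕ} {g h : SD n}
    (hr : SemidirectProduct.rightHom (g * h⁻¹) = 1) (hl : g.left = h.left) : g * h⁻¹ = 1 := by
  rw [mul_inv_eq_one]
  refine SemidirectProduct.ext hl ?_
  rwa [map_mul, map_inv, mul_inv_eq_one] at hr

theorem genSD_rels (n : ℕ) : ∀ r ∈ singularBraidRels n (sLetter n) (tLetter n),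
    FreeGroup.lift (genSD n) r = 1 := by
  intro r hr
  have hright : SemidirectProduct.rightHom (FreeGroup.lift (genSD n) r) = 1 := by
    rw [← MonoidHom.comp_apply, rightHom_comp_lift_genSD]
    exact sPerm_rels n r hr
  have h := map_singularBraidRels (FreeGroup.lift (genSD n)) n _ _ hr
  simp only [lift_genSD_sLetter] at h
  generalize FreeGroup.lift (genSD n) r = g at h hright
  rcases h with (((⟨i, h1, h2, rfl⟩ | ⟨i, j, h1, h2, h3, rfl⟩) | ⟨h, rfl⟩) |
    ⟨i, h1, h2, h3, rfl⟩) | ⟨h, rfl⟩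
  · exact mul_inv_eq_one_of_left_eq hright (by simp)
  · exact mul_inv_eq_one_of_left_eq hright (by simp)
  · rw [lift_genSD_tLetter n (by omega)] at hright ⊢
    refine mul_inv_eq_one_of_left_eq hright ?_
    simp [pow_two, ← map_mul, adjSwap_mul_self, mul_assoc]
  · rw [lift_genSD_tLetter n (by omega)] at hright ⊢
    refine mul_inv_eq_one_of_left_eq hright ?_
    simp only [SemidirectProduct.mul_left, SemidirectProduct.left_inr,
      SemidirectProduct.right_inr, permAut_pairGen, map_one, one_mul, mul_one]
    rcases (by omega : i = 1 ∨ 3 ≤ i) with rfl | hi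
    · have e1 := adjSwap_apply_pred n 1 le_rfl h2
      have e2 := adjSwap_apply_self n 1 le_rfl h2
      simp only [Nat.sub_self] at e1 e2
      rw [e1, e2, pairGen_comm]
    · rw [adjSwap_apply_of_ne _ _ _ (by simp only; omega) (by simp only; omega),
        adjSwap_apply_of_ne _ _ _ (by simp only; omega) (by simp only; omega)]
  · rw [lift_genSD_tLetter n (by omega)] at hright ⊢
    refine mul_inv_eq_one_of_left_eq hright ?_
    have e1 : adjSwap n 1 = Equiv.swap ⟨0, by omega⟩ ⟨1, by omega⟩ := by
      rw [adjSwap, dif_pos (by omega)]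
    have e2 : adjSwap n 2 = Equiv.swap ⟨1, by omega⟩ ⟨2, by omega⟩ := by
      rw [adjSwap, dif_pos (by omega)]
    have e3 : adjSwap n 3 = Equiv.swap ⟨2, by omega⟩ ⟨3, by omega⟩ := by
      rw [adjSwap, dif_pos (by omega)]
    simp only [SemidirectProduct.mul_left, SemidirectProduct.left_inr, SemidirectProduct.mul_right,
      SemidirectProduct.right_inr, permAut_pairGen, map_one, one_mul, mul_one,
      Equiv.Perm.mul_apply, e1, e2, e3, Equiv.swap_apply_def, Fin.mk.injEq]
    norm_num
    -- The block permutation takes `{0, 1}` to `{2, 3}`, so the two sides are the two products of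
    -- `x_{01}` and `x_{23}`. This is the only relator that needs a commutation in the Artin group.
    exact (commute_pairGen (by simp) (by simp) (by simp) (by simp)).eq

/-- The homomorphism from `SG_n` to the semidirect product. -/
def toSD (n : ℕ) : SG n →* SD n := PresentedGroup.toGroup (genSD_rels n)

theorem toSD_σ (n i : ℕ) : toSD n (σ n i) = SemidirectProduct.inr (adjSwap n i) :=
  lift_genSD_sLetter n i

theorem rightHom_toSD (n : ℕ) (g : SG n) :
    SemidirectProduct.rightHom (toSD n g) = sPerm n g := by
  refine QuotientGroup.induction_on g fun w => ?_
  exact DFunLike.congr_fun (rightHom_comp_lift_genSD n) w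

theorem toSD_comp_incl (n : ℕ) :
    (toSD n).comp (incl n) = SemidirectProduct.inr.comp (bPerm n) := by
  ext1 i
  simp only [MonoidHom.comp_apply, incl, bPerm, PresentedGroup.toGroup.of, toSD_σ]

/-- Conjugation by `s_i s_{i+1}` takes `s_i` to `s_{i+1}` and the pair `{i - 1, i}` to `{i, i + 1}`,
matching the recursion for `τ`. The transposition stands on the left so that it cancels in `σ_i
τ_i`. -/
theorem toSD_τ (n : ℕ) : ∀ i (h1 : 1 ≤ i) (h2 : i < n), toSD n (τ n i) =
    SemidirectProduct.inr (adjSwap n i) *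
      SemidirectProduct.inl (pairGen ⟨i - 1, by omega⟩ ⟨i, h2⟩)
  | 0, h, _ => absurd h (by omega)
  | 1, _, h => by
    have e1 := adjSwap_apply_pred n 1 le_rfl h
    have e2 := adjSwap_apply_self n 1 le_rfl h
    simp only [Nat.sub_self] at e1 e2
    refine (lift_genSD_tLetter n h).trans (SemidirectProduct.ext ?_ ?_)
    · simp only [SemidirectProduct.mul_left, SemidirectProduct.left_inr,
        SemidirectProduct.right_inr, SemidirectProduct.left_inl, permAut_pairGen, one_mul,
        Nat.sub_self, e1, e2]
      exact pairGen_comm _ _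
    · simp
  | i + 2, _, h => by
    have ih := toSD_τ n (i + 1) (by omega) (by omega)
    have b := adjSwap_braid n (i + 1) (by omega) h
    have e1 := adjSwap_apply_pred n (i + 1) (by omega) (by omega)
    have e2 := adjSwap_apply_pred n (i + 2) (by omega) h
    have e3 := adjSwap_apply_of_ne n (i + 2) ⟨i, by omega⟩ (by simp) (by simp)
    have e4 := adjSwap_apply_of_ne n (i + 1) ⟨i + 2, h⟩ (by simp) (by simp)
    simp only [Nat.add_sub_cancel, show i + 2 - 1 = i + 1 from rfl] at e1 e2 ih ⊢
    set w := adjSwap n (i + 1) * adjSwap n (i + 2) with hw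
    have hconj : w * adjSwap n (i + 1) * w⁻¹ = adjSwap n (i + 2) := by
      rw [hw, b, mul_inv_rev]
      group
    have hx : permAut n w (pairGen ⟨i, by omega⟩ ⟨i + 1, by omega⟩) =
        pairGen ⟨i + 1, by omega⟩ ⟨i + 2, h⟩ := by
      rw [permAut_pairGen, hw, Equiv.Perm.mul_apply, Equiv.Perm.mul_apply, e3, e1, e2, e4]
    rw [← hx, SemidirectProduct.inl_aut, ← hconj, τ, map_mul, map_mul, map_mul, map_mul, map_inv,
      map_inv, ih, toSD_σ, toSD_σ, hw]
    simp only [map_mul, map_inv]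
    group

theorem toSD_σ_mul_τ (n i : ℕ) (h1 : 1 ≤ i) (h2 : i < n) : toSD n (σ n i * τ n i) =
    SemidirectProduct.inl (pairGen ⟨i - 1, by omega⟩ ⟨i, h2⟩) := by
  rw [map_mul, toSD_σ, toSD_τ n i h1 h2, ← mul_assoc, ← map_mul, adjSwap_mul_self, map_one,
    one_mul]

theorem X_self (n k : ℕ) : X n k k = σ n k * τ n k := by
  simp [X, descProd]

theorem X_succ (n k j : ℕ) (h : k ≤ j) :
    X n k (j + 1) = σ n (j + 1) * X n k j * (σ n (j + 1))⁻¹ := by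
  have : descProd n k (j + 1) = σ n (j + 1) * descProd n k j := by
    rw [descProd, Nat.succ_sub h, List.range'_concat]
    simp only [List.reverse_append, List.map_append, List.prod_append, descProd]
    simp [show k + 1 + (j - k) = j + 1 by omega]
  simp only [X, this]
  group

/-- Passing from `j` to `j + 1` conjugates by `s_{j+1}`, which moves `j` to `j + 1` and fixes the
smaller point `k - 1`. -/
theorem toSD_X (n k j : ℕ) (h1 : 1 ≤ k) (h2 : k ≤ j) (h3 : j < n) : toSD n (X n k j) =
    SemidirectProduct.inl (pairGen ⟨k - 1, by omega⟩ ⟨j, h3⟩) := by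
  induction j, h2 using Nat.le_induction with
  | base => rw [X_self, toSD_σ_mul_τ n k h1 h3]
  | succ j hkj ih =>
    rw [X_succ n k j hkj, map_mul, map_mul, map_inv, ih (by omega), toSD_σ, ← map_inv,
      ← SemidirectProduct.inl_aut, permAut_pairGen,
      adjSwap_apply_of_ne _ _ _ (by simp only; omega) (by simp only; omega)]
    have := adjSwap_apply_pred n (j + 1) (by omega) h3
    simp only [Nat.add_sub_cancel] at this
    rw [this]


/-! ### The quotient of `SG_n` by the normal closure of the pure braid group -/

instance SGP_normal (n : ℕ) : (SGP n).Normal := (sPerm n).normal_ker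

/-- The subgroup `N` as a subgroup of `SG_n`. -/
def NS (n : ℕ) : Subgroup (SG n) := (N n).map (SGP n).subtype

/-- `P_n` is normal in `B_n`, so conjugation by a braid is an automorphism of `SGP_n` that preserves
the generating set of `N`. -/
theorem conj_incl_mem_N (n : ℕ) (b : B n) {x : SGP n} (hx : x ∈ N n) :
    MulAut.conjNormal (incl n b) x ∈ N n := by
  have hle : N n ≤ (N n).comap (MulAut.conjNormal (incl n b)).toMonoidHom := by
    refine Subgroup.normalClosure_le_normal ?_
    rintro y ⟨p, hp, hpy⟩
    refine Subgroup.subset_normalClosure ⟨b * p * b⁻¹, ?_, ?_⟩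
    · exact (bPerm n).normal_ker.conj_mem p hp b
    · rw [map_mul, map_mul, map_inv, hpy]
      rfl
  exact hle hx

/-- Every element of `SG_n` is the product of a pure element and a braid. -/
theorem exists_mul_incl (n : ℕ) (g : SG n) : ∃ (h : SGP n) (b : B n), g = h * incl n b := by
  obtain ⟨b, hb⟩ := bPerm_surjective n (sPerm n g)
  refine ⟨⟨g * (incl n b)⁻¹, ?_⟩, b, by simp⟩
  rw [SGP, MonoidHom.mem_ker, map_mul, map_inv, ← MonoidHom.comp_apply, sPerm_incl, hb,
    mul_inv_cancel]

/-- Normality in `SGP_n` is built in; a general element is a pure element times a braid, and the two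
factors are treated separately. -/
instance NS_normal (n : ℕ) : (NS n).Normal := by
  constructor
  rintro _ ⟨x, hx, rfl⟩ g
  obtain ⟨h, b, rfl⟩ := exists_mul_incl n g
  refine ⟨h * MulAut.conjNormal (incl n b) x * h⁻¹,
    Subgroup.Normal.conj_mem inferInstance _ (conj_incl_mem_N n b hx) h, ?_⟩
  simp only [Subgroup.coe_subtype, Subgroup.coe_mul, Subgroup.coe_inv, MulAut.conjNormal_apply]
  group

theorem incl_mem_NS (n : ℕ) {b : B n} (hb : b ∈ P n) : incl n b ∈ NS n :=
  ⟨⟨incl n b, P_le_SGP n ⟨b, hb, rfl⟩⟩, Subgroup.subset_normalClosure ⟨b, hb, rfl⟩, rfl⟩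

/-- The quotient of `SG_n` by the normal closure of the pure braid group. -/
abbrev SGQ (n : ℕ) : Type := SG n ⧸ NS n

/-- The homomorphism from the symmetric group to the quotient induced by `B_n → SG_n`. -/
noncomputable def permToQ (n : ℕ) : Equiv.Perm (Fin n) →* SGQ n :=
  (QuotientGroup.lift (bPerm n).ker ((QuotientGroup.mk' (NS n)).comp (incl n)) fun _ hb =>
    (QuotientGroup.eq_one_iff _).2 (incl_mem_NS n hb)).comp
  (QuotientGroup.quotientKerEquivOfSurjective (bPerm n) (bPerm_surjective n)).symm.toMonoidHom

theorem permToQ_bPerm (n : ℕ) (b : B n) :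
    permToQ n (bPerm n b) = (incl n b : SGQ n) := by
  have : (QuotientGroup.quotientKerEquivOfSurjective (bPerm n) (bPerm_surjective n)).symm
      (bPerm n b) = (b : B n ⧸ (bPerm n).ker) := by
    rw [MulEquiv.symm_apply_eq]
    rfl
  rw [permToQ, MonoidHom.comp_apply]
  exact (congrArg _ this).trans rfl

theorem permToQ_adjSwap (n i : ℕ) : permToQ n (adjSwap n i) = (σ n i : SGQ n) := by
  by_cases h : 1 ≤ i ∧ i < n
  · have h1 : bPerm n (PresentedGroup.of ⟨i, h⟩) = adjSwap n i := PresentedGroup.toGroup.of _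
    have h2 : incl n (PresentedGroup.of ⟨i, h⟩) = σ n i := PresentedGroup.toGroup.of _
    rw [← h1, ← h2, permToQ_bPerm]
  · rw [adjSwap, dif_neg h, σ_of_not n i h, map_one]
    rfl

/-! ### Conjugates of the class of `σ₁ τ₁` by permutations. -/

theorem σ_comm_τ_one (n i : ℕ) (h1 : 1 ≤ i) (h2 : i < n) (h3 : i ≠ 2) :
    Commute (σ n i) (τ n 1) := by
  rw [Commute, SemiconjBy, ← mul_inv_eq_one]
  exact PresentedGroup.one_of_mem (rels := singularBraidRels n (sLetter n) (tLetter n))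
    (Or.inl (Or.inr ⟨i, h1, h2, h3, rfl⟩))

theorem τ_one_four_term (n : ℕ) (h : 3 < n) :
    σ n 2 * σ n 3 * σ n 1 * σ n 2 * τ n 1 * σ n 2 * σ n 3 * σ n 1 * σ n 2 * τ n 1 =
      τ n 1 * σ n 2 * σ n 3 * σ n 1 * σ n 2 * τ n 1 * σ n 2 * σ n 3 * σ n 1 * σ n 2 := by
  rw [← mul_inv_eq_one]
  exact PresentedGroup.one_of_mem (rels := singularBraidRels n (sLetter n) (tLetter n))
    (Or.inr ⟨h, rfl⟩)

/-- The class of `σ₁ τ₁`. -/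
def baseQ (n : ℕ) : SGQ n := ((σ n 1 * τ n 1 : SG n) : SGQ n)

theorem baseQ_eq (n : ℕ) : baseQ n = permToQ n (adjSwap n 1) * (τ n 1 : SGQ n) := by
  rw [permToQ_adjSwap]
  rfl

theorem commute_permToQ_τ_one (n i : ℕ) (h1 : 1 ≤ i) (h2 : i < n) (h3 : i ≠ 2) :
    Commute (permToQ n (adjSwap n i)) (τ n 1 : SGQ n) := by
  rw [permToQ_adjSwap]
  exact (σ_comm_τ_one n i h1 h2 h3).map (QuotientGroup.mk' (NS n))

theorem commute_permToQ_baseQ (n i : ℕ) (h1 : 1 ≤ i) (h2 : i < n) (h3 : i ≠ 2) :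
    Commute (permToQ n (adjSwap n i)) (baseQ n) := by
  rw [baseQ_eq]
  refine Commute.mul_right ?_ (commute_permToQ_τ_one n i h1 h2 h3)
  refine Commute.map ?_ (permToQ n)
  rcases (by omega : i = 1 ∨ 1 + 1 < i) with rfl | hi
  · exact Commute.refl _
  · exact (adjSwap_comm n 1 i hi).symm

/-- The conjugate of `σ₁ τ₁` by a permutation. -/
noncomputable def conjQ {n : ℕ} (π : Equiv.Perm (Fin n)) : SGQ n :=
  permToQ n π * baseQ n * (permToQ n π)⁻¹

theorem conjQ_mul {n : ℕ} (π ρ : Equiv.Perm (Fin n)) :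
    conjQ (π * ρ) = permToQ n π * conjQ ρ * (permToQ n π)⁻¹ := by
  simp only [conjQ, map_mul]
  group

theorem conjQ_mul_of_commute {n : ℕ} (π ρ : Equiv.Perm (Fin n))
    (h : Commute (permToQ n ρ) (baseQ n)) : conjQ (π * ρ) = conjQ π := by
  have h' : conjQ ρ = baseQ n := by rw [conjQ, h.eq, mul_inv_cancel_right]
  rw [conjQ_mul, h', conjQ]

/-- Two such permutations differ by one fixing the points `0` and `1`. These are generated by the
`s_i` with `i ≥ 3`, all of which commute with `baseQ n`. -/
theorem conjQ_congr {n : ℕ} (h : 2 ≤ n) {π ρ : Equiv.Perm (Fin n)}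
    (h0 : π ⟨0, by omega⟩ = ρ ⟨0, by omega⟩) (h1 : π ⟨1, by omega⟩ = ρ ⟨1, by omega⟩) :
    conjQ π = conjQ ρ := by
  have hmem : ρ⁻¹ * π ∈ (Subgroup.centralizer {baseQ n}).comap (permToQ n) := by
    refine mem_of_adjSwap_mem _ 2 (fun i hi hin => ?_) _ (fun x hx => ?_)
    · rw [Subgroup.mem_comap, Subgroup.mem_centralizer_singleton_iff]
      exact (commute_permToQ_baseQ n i (by omega) hin (by omega)).eq
    · rw [Equiv.Perm.mul_apply, Equiv.Perm.inv_eq_iff_eq]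
      rcases (by omega : (x : ℕ) = 0 ∨ (x : ℕ) = 1) with hx | hx
      · rwa [show x = ⟨0, by omega⟩ from Fin.ext hx]
      · rwa [show x = ⟨1, by omega⟩ from Fin.ext hx]
  rw [Subgroup.mem_comap, Subgroup.mem_centralizer_singleton_iff] at hmem
  have := conjQ_mul_of_commute ρ (ρ⁻¹ * π) hmem
  rwa [mul_inv_cancel_left] at this

theorem conjQ_mul_adjSwap_one {n : ℕ} (h : 2 ≤ n) (π : Equiv.Perm (Fin n)) :
    conjQ (π * adjSwap n 1) = conjQ π :=
  conjQ_mul_of_commute _ _ (commute_permToQ_baseQ n 1 le_rfl h (by omega))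

/-- The permutation that exchanges the first two points with the next two. -/
def blockSwap (n : ℕ) : Equiv.Perm (Fin n) :=
  adjSwap n 2 * adjSwap n 3 * adjSwap n 1 * adjSwap n 2

theorem blockSwap_apply (n : ℕ) (h : 3 < n) :
    blockSwap n ⟨0, by omega⟩ = ⟨2, by omega⟩ ∧ blockSwap n ⟨1, by omega⟩ = ⟨3, h⟩ := by
  have e1 : adjSwap n 1 = Equiv.swap ⟨0, by omega⟩ ⟨1, by omega⟩ := by
    rw [adjSwap, dif_pos (by omega)]
  have e2 : adjSwap n 2 = Equiv.swap ⟨1, by omega⟩ ⟨2, by omega⟩ := by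
    rw [adjSwap, dif_pos (by omega)]
  have e3 : adjSwap n 3 = Equiv.swap ⟨2, by omega⟩ ⟨3, by omega⟩ := by
    rw [adjSwap, dif_pos (by omega)]
  simp [blockSwap, e1, e2, e3, Equiv.swap_apply_def]

theorem blockSwap_mul_self (n : ℕ) : blockSwap n * blockSwap n = 1 := by
  have q := adjSwap_mul_self n
  have c := adjSwap_comm n 1 3 (by omega)
  calc blockSwap n * blockSwap n
      = adjSwap n 2 * (adjSwap n 3 * (adjSwap n 1 * (adjSwap n 2 * adjSwap n 2) * adjSwap n 3) *
          adjSwap n 1) * adjSwap n 2 := by simp only [blockSwap, mul_assoc]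
    _ = 1 := by
      rw [q, mul_one, c, ← mul_assoc (adjSwap n 3), q, one_mul, mul_assoc (adjSwap n 2), q, one_mul,
        q]

theorem blockSwap_mul_adjSwap_one (n : ℕ) (h : 3 < n) :
    blockSwap n * adjSwap n 1 = adjSwap n 3 * blockSwap n := by
  have b1 := adjSwap_braid n 1 le_rfl (by omega)
  have b2 := adjSwap_braid n 2 (by omega) h
  calc blockSwap n * adjSwap n 1
      = adjSwap n 2 * adjSwap n 3 * (adjSwap n 1 * adjSwap n 2 * adjSwap n 1) := by
        simp only [blockSwap, mul_assoc]
    _ = adjSwap n 2 * adjSwap n 3 * adjSwap n 2 * (adjSwap n 1 * adjSwap n 2) := by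
        rw [b1]; simp only [mul_assoc]
    _ = adjSwap n 3 * blockSwap n := by rw [b2]; simp only [blockSwap, mul_assoc]

/-- Meant for `s = s₁`, `s' = s₃`, `t = τ₁` and `w` the block exchange. The conjugate of `s t` is
`s' (w t w)`. The last hypothesis says that `t` commutes with `w t w`, and `s` commutes with `w t w`
because `s'` commutes with `t`. -/
theorem commute_mul_conj {G : Type*} [Group G] {w s s' t : G} (hw : w * w = 1)
    (hws : w * s = s' * w) (hs' : Commute s' t) (hss' : Commute s s')
    (h : w * t * w * t = t * w * t * w) : Commute (s * t) (w * (s * t) * w⁻¹) := by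
  have hinv : w⁻¹ = w := inv_eq_of_mul_eq_one_left hw
  have hconj : w * (s * t) * w⁻¹ = s' * (w * t * w) := by
    rw [hinv, ← mul_assoc, hws]
    simp only [mul_assoc]
  have hu : Commute t (w * t * w) := by
    rw [Commute, SemiconjBy]
    simpa only [mul_assoc] using h.symm
  have hws' : w * s' = s * w := by
    have := congrArg (fun x => w * x * w) hws
    simp only [mul_assoc, hw, mul_one] at this
    rw [← mul_assoc, hw, one_mul] at this
    exact this.symm
  have hsu : Commute s (w * t * w) := by
    calc s * (w * t * w) = w * (s' * t) * w := by
          rw [← mul_assoc, ← mul_assoc, ← hws']; simp only [mul_assoc]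
      _ = w * t * (s' * w) := by rw [hs'.eq]; simp only [mul_assoc]
      _ = w * t * w * s := by rw [← hws]; simp only [mul_assoc]
  rw [hconj]
  exact (hss'.mul_right hsu).mul_left (hs'.symm.mul_right hu)

theorem commute_conjQ_blockSwap (n : ℕ) (h : 3 < n) :
    Commute (baseQ n) (conjQ (blockSwap n)) := by
  rw [conjQ, baseQ_eq]
  refine commute_mul_conj (s' := permToQ n (adjSwap n 3)) ?_ ?_
    (commute_permToQ_τ_one n 3 (by omega) h (by omega))
    (Commute.map (adjSwap_comm n 1 3 (by omega)) _) ?_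
  · rw [← map_mul, blockSwap_mul_self, map_one]
  · rw [← map_mul, ← map_mul, blockSwap_mul_adjSwap_one n h]
  · have := congrArg (QuotientGroup.mk' (NS n)) (τ_one_four_term n h)
    simp only [map_mul, QuotientGroup.mk'_apply, ← permToQ_adjSwap] at this
    simpa only [blockSwap, map_mul, mul_assoc] using this

/-- Four distinct points force `n > 3`, and some `θ` takes `0, 1, 2, 3` to them. Then `π` may be
replaced by `θ` and `ρ` by `θ * blockSwap n`, and conjugation by `θ` reduces to
`commute_conjQ_blockSwap`. -/
theorem commute_conjQ {n : ℕ} (h : 2 ≤ n) (π ρ : Equiv.Perm (Fin n))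
    (h1 : π ⟨0, by omega⟩ ≠ ρ ⟨0, by omega⟩) (h2 : π ⟨0, by omega⟩ ≠ ρ ⟨1, by omega⟩)
    (h3 : π ⟨1, by omega⟩ ≠ ρ ⟨0, by omega⟩) (h4 : π ⟨1, by omega⟩ ≠ ρ ⟨1, by omega⟩) :
    Commute (conjQ π) (conjQ ρ) := by
  have hp : π ⟨0, by omega⟩ ≠ π ⟨1, by omega⟩ := π.injective.ne (by simp)
  have hr : ρ ⟨0, by omega⟩ ≠ ρ ⟨1, by omega⟩ := ρ.injective.ne (by simp)
  have hinj : Function.Injective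
      ![π ⟨0, by omega⟩, π ⟨1, by omega⟩, ρ ⟨0, by omega⟩, ρ ⟨1, by omega⟩] := by
    intro i j hij
    fin_cases i <;> fin_cases j <;> simp_all
  have hn : 3 < n := by
    have := Fintype.card_le_of_injective _ hinj
    simp only [Fintype.card_fin] at this
    omega
  obtain ⟨θ, hθ⟩ := exists_perm_apply_eq
    (f := fun i : Fin 4 => (⟨i, by omega⟩ : Fin n))
    (fun i j hij => Fin.ext (by simpa using hij)) hinj
  have t0 : θ ⟨0, by omega⟩ = π ⟨0, by omega⟩ := hθ 0
  have t1 : θ ⟨1, by omega⟩ = π ⟨1, by omega⟩ := hθ 1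
  have t2 : θ ⟨2, by omega⟩ = ρ ⟨0, by omega⟩ := hθ 2
  have t3 : θ ⟨3, by omega⟩ = ρ ⟨1, by omega⟩ := hθ 3
  obtain ⟨b0, b1⟩ := blockSwap_apply n hn
  have e1 : conjQ π = permToQ n θ * baseQ n * (permToQ n θ)⁻¹ :=
    conjQ_congr h t0.symm t1.symm
  have e2 : conjQ ρ = conjQ (θ * blockSwap n) := by
    refine conjQ_congr h ?_ ?_
    · rw [Equiv.Perm.mul_apply, b0, t2]
    · rw [Equiv.Perm.mul_apply, b1, t3]
  rw [e1, e2, conjQ_mul]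
  exact (commute_conjQ_blockSwap n hn).map (MulAut.conj (permToQ n θ)).toMonoidHom

theorem exists_perm_of_pair {n : ℕ} (h : 2 ≤ n) (p : XIdx n) :
    ∃ π : Equiv.Perm (Fin n), π ⟨0, by omega⟩ = p.fst ∧ π ⟨1, by omega⟩ = p.snd := by
  have hp := p.fst_lt_snd.ne
  have hinj : Function.Injective ![p.fst, p.snd] := by
    intro i j hij
    fin_cases i <;> fin_cases j <;> simp_all
  obtain ⟨π, hπ⟩ := exists_perm_apply_eq
    (f := fun i : Fin 2 => (⟨i, by omega⟩ : Fin n))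
    (fun i j hij => Fin.ext (by simpa using hij)) hinj
  exact ⟨π, hπ 0, hπ 1⟩

/-- A permutation that carries the first two points to the pair of the generator `x_p`. -/
noncomputable def pairPerm {n : ℕ} (h : 2 ≤ n) (p : XIdx n) : Equiv.Perm (Fin n) :=
  (exists_perm_of_pair h p).choose

theorem pairPerm_spec {n : ℕ} (h : 2 ≤ n) (p : XIdx n) :
    pairPerm h p ⟨0, by omega⟩ = p.fst ∧ pairPerm h p ⟨1, by omega⟩ = p.snd :=
  (exists_perm_of_pair h p).choose_spec

/-- The homomorphism from the right-angled Artin group to the quotient of `SG_n`. -/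
noncomputable def raToQ {n : ℕ} (h : 2 ≤ n) : RA n →* SGQ n :=
  PresentedGroup.toGroup (commRels_lift (fun p => conjQ (pairPerm h p)) fun p q h1 h2 h3 h4 => by
    rw [← (pairPerm_spec h p).1] at h1 h2
    rw [← (pairPerm_spec h p).2] at h3 h4
    rw [← (pairPerm_spec h q).1] at h1 h3
    rw [← (pairPerm_spec h q).2] at h2 h4
    exact commute_conjQ h _ _ h1 h2 h3 h4)

/-- Frees `raToQ` from the choice of `pairPerm`, and from the order of the two points: if `π`
reverses it, `π * adjSwap n 1` does not and has the same conjugate. -/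
theorem raToQ_pairGen {n : ℕ} (h : 2 ≤ n) (π : Equiv.Perm (Fin n)) :
    raToQ h (pairGen (π ⟨0, by omega⟩) (π ⟨1, by omega⟩)) = conjQ π := by
  have key : ∀ π : Equiv.Perm (Fin n), π ⟨0, by omega⟩ < π ⟨1, by omega⟩ →
      raToQ h (pairGen (π ⟨0, by omega⟩) (π ⟨1, by omega⟩)) = conjQ π := by
    intro π hπ
    obtain ⟨p, h1, h2⟩ := exists_of_lt hπ
    rw [← h1, ← h2, pairGen_fst_snd, raToQ, PresentedGroup.toGroup.of]
    exact conjQ_congr h ((pairPerm_spec h p).1.trans h1) ((pairPerm_spec h p).2.trans h2)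
  have hne : π ⟨0, by omega⟩ ≠ π ⟨1, by omega⟩ := π.injective.ne (by simp)
  rcases lt_or_gt_of_ne hne with hπ | hπ
  · exact key π hπ
  · have e1 := adjSwap_apply_pred n 1 le_rfl h
    have e2 := adjSwap_apply_self n 1 le_rfl h
    simp only [Nat.sub_self] at e1 e2
    have := key (π * adjSwap n 1)
    simp only [Equiv.Perm.mul_apply, e1, e2, conjQ_mul_adjSwap_one h] at this
    rw [pairGen_comm]
    exact this hπ

/-- On the generator of the pair `{π 0, π 1}` both sides give `conjQ (ρ * π)`. -/
theorem raToQ_equivariant {n : ℕ} (h : 2 ≤ n) (ρ : Equiv.Perm (Fin n)) :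
    (raToQ h).comp (permAut n ρ).toMonoidHom =
      (MulAut.conj (permToQ n ρ)).toMonoidHom.comp (raToQ h) := by
  ext p
  obtain ⟨π, h0, h1⟩ := exists_perm_of_pair h p
  rw [MonoidHom.comp_apply, MonoidHom.comp_apply, ← pairGen_fst_snd, ← h0, ← h1,
    raToQ_pairGen h π]
  change raToQ h (permAut n ρ _) = permToQ n ρ * conjQ π * (permToQ n ρ)⁻¹
  rw [permAut_pairGen, ← conjQ_mul]
  exact raToQ_pairGen h (ρ * π)


/-! ### The kernel of the homomorphism to the semidirect product -/

/-- The homomorphism from the semidirect product to the quotient of `SG_n`. -/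
noncomputable def sdToQ {n : ℕ} (h : 2 ≤ n) : SD n →* SGQ n :=
  SemidirectProduct.lift (raToQ h) (permToQ n) (raToQ_equivariant h)

theorem sdToQ_toSD_σ {n : ℕ} (h : 2 ≤ n) (i : ℕ) :
    sdToQ h (toSD n (σ n i)) = (σ n i : SGQ n) := by
  rw [toSD_σ, sdToQ, SemidirectProduct.lift_inr, permToQ_adjSwap]

theorem sdToQ_toSD_τ_one {n : ℕ} (h : 2 ≤ n) :
    sdToQ h (toSD n (τ n 1)) = (τ n 1 : SGQ n) := by
  have hx : raToQ h (pairGen ⟨0, by omega⟩ ⟨1, by omega⟩) = baseQ n := by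
    have := raToQ_pairGen h 1
    simpa [conjQ] using this
  have := toSD_σ_mul_τ n 1 le_rfl h
  simp only [Nat.sub_self] at this
  have := congrArg (sdToQ h) this
  rw [map_mul, map_mul, sdToQ_toSD_σ, sdToQ, SemidirectProduct.lift_inl, hx, baseQ,
    QuotientGroup.mk_mul] at this
  -- The value on `σ₁ τ₁` is known directly; cancelling `σ₁` leaves `τ₁`.
  exact mul_left_cancel this

/-- Only this composite is needed: it forces the kernel of `toSD` into `NS n`. -/
theorem sdToQ_comp_toSD {n : ℕ} (h : 2 ≤ n) :
    (sdToQ h).comp (toSD n) = QuotientGroup.mk' (NS n) := by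
  ext g
  cases g with
  | sigma i =>
    have hi : σ n i = PresentedGroup.of (SGen.sigma i) := by
      simp [σ, sLetter, i.2.1, i.2.2, PresentedGroup.of]
    rw [← hi]
    exact sdToQ_toSD_σ h i
  | tauOne h' =>
    have hi : τ n 1 = PresentedGroup.of (SGen.tauOne h') :=
      congrArg (PresentedGroup.mk _) (dif_pos h')
    rw [← hi]
    exact sdToQ_toSD_τ_one h

theorem mem_NS_of_toSD_eq_one {n : ℕ} (h : 2 ≤ n) {g : SG n} (hg : toSD n g = 1) :
    g ∈ NS n := by
  have := DFunLike.congr_fun (sdToQ_comp_toSD h) g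
  rw [MonoidHom.comp_apply, hg, map_one] at this
  exact (QuotientGroup.eq_one_iff g).1 this.symm

/-! ### The pure singular braid group -/

theorem toSD_right_of_mem_SGP {n : ℕ} (g : SGP n) : (toSD n g).right = 1 :=
  (rightHom_toSD n g).trans g.2

/-- The homomorphism from `SGP_n` to the right-angled Artin group. -/
def toRA (n : ℕ) : SGP n →* RA n :=
  -- On pure elements the permutation component is trivial, so the twist in the product disappears
  -- and the left component is multiplicative.
  MonoidHom.mk' (fun g => (toSD n g).left) fun g h => by
    rw [Subgroup.coe_mul, map_mul, SemidirectProduct.mul_left, toSD_right_of_mem_SGP, map_one]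
    rfl

theorem toSD_eq_inl {n : ℕ} (g : SGP n) : toSD n g = SemidirectProduct.inl (toRA n g) :=
  SemidirectProduct.ext rfl (toSD_right_of_mem_SGP g)

theorem toRA_XGen {n : ℕ} (p : XIdx n) : toRA n (XGen n p) = PresentedGroup.of p := by
  apply SemidirectProduct.inl_injective (φ := permAut n)
  rw [← toSD_eq_inl, ← pairGen_fst_snd]
  exact toSD_X n _ _ p.2.1 p.2.2.1 p.2.2.2

theorem toRA_surjective (n : ℕ) : Function.Surjective (toRA n) := by
  rw [← MonoidHom.range_eq_top, eq_top_iff, ← PresentedGroup.closure_range_of,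
    Subgroup.closure_le]
  rintro _ ⟨p, rfl⟩
  exact ⟨XGen n p, toRA_XGen p⟩

theorem toRA_ker {n : ℕ} (h : 2 ≤ n) : (toRA n).ker = N n := by
  apply le_antisymm
  · intro g hg
    have hg' : toSD n g = 1 := by
      rw [toSD_eq_inl, (MonoidHom.mem_ker).1 hg, map_one]
    obtain ⟨x, hx, hxg⟩ := mem_NS_of_toSD_eq_one h hg'
    rwa [← Subtype.ext hxg]
  · refine Subgroup.normalClosure_le_normal ?_
    rintro g ⟨b, hb, hbg⟩
    have hbg : incl n b = g := hbg
    have hb : bPerm n b = 1 := hb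
    apply SemidirectProduct.inl_injective (φ := permAut n)
    rw [← toSD_eq_inl, ← hbg, ← MonoidHom.comp_apply, toSD_comp_incl, MonoidHom.comp_apply, hb,
      map_one, map_one]

/-- Covers `n < 2`, where the points `0` and `1` used to build `sdToQ` are not both available. -/
theorem SG_subsingleton {n : ℕ} (h : n < 2) : Subsingleton (SG n) := by
  have : IsEmpty (SGen n) := ⟨fun g => by
    cases g with
    | sigma i => have := i.2; omega
    | tauOne h' => omega⟩
  exact (PresentedGroup.mk_surjective _).subsingleton

theorem toRA_ker_eq_N (n : ℕ) : (toRA n).ker = N n := by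
  rcases lt_or_ge n 2 with h | h
  · have := SG_subsingleton h
    exact Subsingleton.elim _ _
  · exact toRA_ker h

/-- The isomorphism of the quotient of `SGP_n` with the right-angled Artin group. -/
noncomputable def quotientEquivRA (n : ℕ) : SGP n ⧸ N n ≃* RA n :=
  (QuotientGroup.quotientMulEquivOfEq (toRA_ker_eq_N n).symm).trans
    (QuotientGroup.quotientKerEquivOfSurjective (toRA n) (toRA_surjective n))

theorem quotientEquivRA_XGen (n : ℕ) (p : XIdx n) :
    quotientEquivRA n (QuotientGroup.mk (XGen n p)) = PresentedGroup.of p :=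
  toRA_XGen p

end SingularBraid

theorem mainTheorem10 (n : ℕ) :
    ∃ e : PresentedGroup (SingularBraid.commRels n) ≃* SingularBraid.SGP n ⧸ SingularBraid.N n,
      ∀ p : SingularBraid.XIdx n,
        e (PresentedGroup.of p) = QuotientGroup.mk (SingularBraid.XGen n p) :=
  ⟨(SingularBraid.quotientEquivRA n).symm, fun p =>
    (MulEquiv.symm_apply_eq _).2 (SingularBraid.quotientEquivRA_XGen n p).symm⟩
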